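/- For integers $p,q\ge 0$, a signed $(p,q)$-involution is a permutation $\pi$ of $\{1,\dots,p+q\}$ with $\pi^2=\mathrm{id}$, together with an assignment of a sign $+$ or $-$ to each fixed point of $\pi$ such that the number of $+$ signs minus the number of $-$ signs equals $p-q$. Let $\alpha_{p,q}$ denote the number of signed $(p,q)$-involutions (so $\alpha_{p,0}=\alpha_{0,q}=1$). Then there is $\varepsilon>0$ such that for all complex numbers $x,y$ with $|x|<\varepsilon$, $|y|<\varepsilon$ the double series $\sum_{p,q\ge 0}\alpha_{p,q}\,x^q\frac{y^p}{p!}$ converges absolutely and, if $x\neq 0$, $$\sum_{p,q\ge 0}\alpha_{p,q}\,x^q\,\frac{y^p}{p!}=\frac{e^{\frac{1-x-\sqrt{x^2-2xy-2x+1}}{x}}\,\bigl(x-\sqrt{x^2-2xy-2x+1}\bigr)}{-x^2+2xy+2x-1+x\sqrt{x^2-2xy-2x+1}},$$ where $\sqrt{\cdot}$ is the principal branch of the square root and the denominator on the right-hand side is nonzero. For $x=0$ the sum of the series is $e^{y}$. -/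

import Mathlib

/-- Signed `(p,q)`-involutions: permutations `π` of `{1, …, p + q}` (here `Fin (p + q)`) with
`π² = id`, together with a sign on every fixed point of `π` (`true` is `+`, `false` is `-`),
such that the number of `+` signs minus the number of `-` signs equals `p - q`, as integers. -/
def signedInvolutions (p q : ℕ) :
    Set (Σ π : Equiv.Perm (Fin (p + q)), ({i : Fin (p + q) // π i = i} → Bool)) :=
  {w | w.1 ^ 2 = 1 ∧
    ((Finset.univ.filter (fun i => w.2 i = true)).card : ℤ)
      - ((Finset.univ.filter (fun i => w.2 i = false)).card : ℤ) = (p : ℤ) - (q : ℤ)}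

/-- The number `α_{p,q}` of signed `(p,q)`-involutions (of a subset of a finite type). -/
noncomputable def signedInvolutionCount (p q : ℕ) : ℕ := (signedInvolutions p q).ncard

/-- The principal branch of `√(x² - 2xy - 2x + 1)`; it equals `1` at `x = y = 0`. -/
noncomputable def discSqrt (x y : ℂ) : ℂ := (x ^ 2 - 2 * x * y - 2 * x + 1) ^ (1 / 2 : ℂ)

/-! An involution with `a` plus signs, `b` minus signs and `k` two-cycles has `p = a + k` and `q = b
+ k`. Counting by cycle type and dividing by `p!` turns the double series into the sum over `(a, k,
b)` of `tripleTerm`, which converges absolutely. Summing over `b` is a negative binomial series;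
over `k` it leaves `∑ (a + 2k choose k) z ^ k = c ^ a / S`, with `z = xy / (2(1 - x)²)`, `S = √(1 -
4z)` and `c = 2 / (1 + S)`; over `a` it is an exponential. With `R = discSqrt x y = (1 - x) S` the
result is `exp (2y / (1 - x + R)) / R`. The stated form follows from `(1 - x - R)(1 - x + R) = 2xy`.
-/

/-! ### Counting signed involutions by two-cycles -/

theorem card_filter_card_eq_true {α : Type*} [Fintype α] [DecidableEq α] (j : ℕ) :
    (Finset.univ.filter (fun f : α → Bool => (Finset.univ.filter (fun i => f i = true)).card = j)).card
      = (Fintype.card α).choose j := by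
  rw [← Finset.card_univ (α := α), ← Finset.card_powersetCard]
  refine Finset.card_nbij' (fun f => Finset.univ.filter (fun i => f i = true))
    (fun s i => decide (i ∈ s)) ?_ ?_ ?_ ?_
  · intro f hf
    simpa [Finset.mem_powersetCard] using hf
  · intro s hs
    simpa [Finset.mem_powersetCard] using hs
  · intro f _
    simp
  · intro s _
    simp

/-- With `k` two-cycles the sum and the difference of the sign counts force `p - k` plus signs and
`q - k` minus signs. -/
theorem card_filter_signs {α : Type*} [Fintype α] [DecidableEq α] {p q k : ℕ}
    (h : Fintype.card α + 2 * k = p + q) :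
    (Finset.univ.filter (fun f : α → Bool =>
      ((Finset.univ.filter (fun i => f i = true)).card : ℤ)
        - ((Finset.univ.filter (fun i => f i = false)).card : ℤ) = (p : ℤ) - (q : ℤ))).card
      = if k ≤ p ∧ k ≤ q then (p + q - 2 * k).choose (p - k) else 0 := by
  have hsum (f : α → Bool) : (Finset.univ.filter (fun i => f i = true)).card
      + (Finset.univ.filter (fun i => f i = false)).card = Fintype.card α := by
    simpa using Finset.card_filter_add_card_filter_not (s := Finset.univ) (fun i => f i = true)
  split_ifs with hk
  · rw [show p + q - 2 * k = Fintype.card α by omega, ← card_filter_card_eq_true]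
    congr 1
    ext f
    have := hsum f
    simp only [Finset.mem_filter, Finset.mem_univ, true_and]
    omega
  · rw [Finset.card_eq_zero, Finset.filter_eq_empty_iff]
    intro f _ hf
    have := hsum f
    omega

theorem card_cycleType_replicate_two_mul {n k : ℕ} (h : 2 * k ≤ n) :
    (Finset.univ.filter
        (fun π : Equiv.Perm (Fin n) => π.cycleType = Multiset.replicate k 2)).card
      * ((n - 2 * k).factorial * 2 ^ k * k.factorial) = n.factorial := by
  have := Equiv.Perm.card_of_cycleType_mul_eq (α := Fin n) (Multiset.replicate k 2)
  rw [if_pos ⟨by simpa [mul_comm] using h,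
    fun a ha => (Multiset.eq_of_mem_replicate ha).ge⟩] at this
  rcases Nat.eq_zero_or_pos k with rfl | hk
  · simpa using this
  · simpa [Multiset.toFinset_replicate, hk.ne', mul_comm k 2] using this

theorem signedInvolutionCount_eq_sum (p q : ℕ) :
    signedInvolutionCount p q = ∑ k ∈ Finset.range (p + q + 1),
      (Finset.univ.filter
        (fun π : Equiv.Perm (Fin (p + q)) => π.cycleType = Multiset.replicate k 2)).card
      * if k ≤ p ∧ k ≤ q then (p + q - 2 * k).choose (p - k) else 0 := by
  classical
  set c : ℕ → ℕ := fun k => if k ≤ p ∧ k ≤ q then (p + q - 2 * k).choose (p - k) else 0 with hc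
  have hset : signedInvolutions p q =
      (((Finset.univ.filter (fun π : Equiv.Perm (Fin (p + q)) => π ^ 2 = 1)).sigma
        (fun π => Finset.univ.filter (fun f : {i : Fin (p + q) // π i = i} → Bool =>
          ((Finset.univ.filter (fun i => f i = true)).card : ℤ)
          - ((Finset.univ.filter (fun i => f i = false)).card : ℤ) = (p : ℤ) - (q : ℤ))) :
        Finset _) : Set _) := by
    ext w
    simp [signedInvolutions]
  have hcard (π : Equiv.Perm (Fin (p + q))) (hπ : π ^ 2 = 1) :
      Fintype.card {i : Fin (p + q) // π i = i} + 2 * π.cycleType.card = p + q := by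
    have h1 := π.card_fixedPoints
    have h2 := π.sum_cycleType_le
    have h3 : π.cycleType.sum = 2 * π.cycleType.card := by
      conv_lhs => rw [Equiv.Perm.cycleType_of_pow_prime_eq_one hπ]
      simp [mul_comm]
    have h4 : Fintype.card {i : Fin (p + q) // π i = i}
        = Fintype.card (Function.fixedPoints π) := Fintype.card_congr (Equiv.refl _)
    rw [Fintype.card_fin] at h1 h2
    omega
  rw [signedInvolutionCount, hset, Set.ncard_coe_finset, Finset.card_sigma]
  have hterm : ∀ π ∈ Finset.univ.filter (fun π : Equiv.Perm (Fin (p + q)) => π ^ 2 = 1),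
      (Finset.univ.filter (fun f : {i : Fin (p + q) // π i = i} → Bool =>
          ((Finset.univ.filter (fun i => f i = true)).card : ℤ)
          - ((Finset.univ.filter (fun i => f i = false)).card : ℤ) = (p : ℤ) - (q : ℤ))).card
        = c π.cycleType.card := by
    intro π hπ
    convert card_filter_signs (hcard π (Finset.mem_filter.1 hπ).2)
  rw [Finset.sum_congr rfl hterm,
    ← Finset.sum_fiberwise_of_maps_to (g := fun π => π.cycleType.card)
      (t := Finset.range (p + q + 1))]
  · refine Finset.sum_congr rfl fun k _ => ?_
    rw [Finset.filter_filter, Finset.sum_congr rfl (g := fun _ => c k), Finset.sum_const,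
      smul_eq_mul]
    · congr 2
      ext π
      simp only [Finset.mem_filter, Finset.mem_univ, true_and]
      constructor
      · rintro ⟨h1, rfl⟩
        exact Equiv.Perm.cycleType_of_pow_prime_eq_one h1
      · intro h
        refine ⟨Equiv.Perm.pow_prime_eq_one_iff.2 fun a ha => ?_, by rw [h]; simp⟩
        rw [h] at ha
        exact Multiset.eq_of_mem_replicate ha
    · intro π hπ
      rw [(Finset.mem_filter.1 hπ).2.2]
  · intro π hπ
    have := hcard π (Finset.mem_filter.1 hπ).2
    simp only [Finset.mem_range]
    omega

/-- The contribution to `α_{a+k,b+k}` of the involutions with `k` two-cycles, divided by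
`(a + k)!`. -/
theorem card_cycleType_replicate_two_mul_choose_div_factorial (k a b : ℕ) :
    ((Finset.univ.filter (fun π : Equiv.Perm (Fin (a + k + (b + k))) =>
        π.cycleType = Multiset.replicate k 2)).card : ℂ)
      * ((a + k + (b + k) - 2 * k).choose (a + k - k) : ℂ) / ((a + k).factorial : ℂ)
      = ((b + (a + 2 * k)).choose (a + 2 * k) : ℂ) * ((a + 2 * k).choose k : ℂ)
        / (2 ^ k * a.factorial) := by
  have h1 := card_cycleType_replicate_two_mul (n := a + k + (b + k)) (k := k) (by omega)
  have e1 : a + k + (b + k) - 2 * k = a + b := by omega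
  have h2 := Nat.add_choose_mul_factorial_mul_factorial a b
  rw [← Nat.choose_symm_add] at h2
  have h3 := Nat.add_choose_mul_factorial_mul_factorial b (a + 2 * k)
  have h4 := Nat.add_choose_mul_factorial_mul_factorial (a + k) k
  rw [show a + k + k = a + 2 * k by ring] at h4
  rw [show b + (a + 2 * k) = a + k + (b + k) by ring] at h3 ⊢
  rw [e1] at h1 ⊢
  rw [Nat.add_sub_cancel]
  generalize (Finset.univ.filter (fun π : Equiv.Perm (Fin (a + k + (b + k))) =>
        π.cycleType = Multiset.replicate k 2)).card = N at h1 ⊢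
  have f (n : ℕ) : (n.factorial : ℂ) ≠ 0 := Nat.cast_ne_zero.2 n.factorial_ne_zero
  rw [div_eq_div_iff (f _) (by simp [f])]
  -- Multiplied by `b! k!`, both sides become multiples of `(a + b + 2k)!`.
  have key : N * (a + b).choose a * (2 ^ k * a.factorial) * (b.factorial * k.factorial)
      = (a + k + (b + k)).choose (a + 2 * k) * (a + 2 * k).choose k * (a + k).factorial
        * (b.factorial * k.factorial) := by
    calc _ = N * ((a + b).choose a * a.factorial * b.factorial * 2 ^ k * k.factorial) := by ring
      _ = (a + k + (b + k)).factorial := by rw [h2, h1]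
      _ = (a + k + (b + k)).choose (a + 2 * k) * b.factorial *
            ((a + 2 * k).choose k * (a + k).factorial * k.factorial) := by rw [h4, h3]
      _ = _ := by ring
  have := Nat.eq_of_mul_eq_mul_right
    (Nat.mul_pos b.factorial_pos k.factorial_pos) key
  exact_mod_cast this

/-! ### Generating functions of `(a + 2k choose k)` -/

theorem norm_choose_add_two_mul_mul_pow_le (a k : ℕ) (z : ℂ) :
    ‖((a + 2 * k).choose k : ℂ) * z ^ k‖ ≤ 2 ^ a * (4 * ‖z‖) ^ k := by
  have h : ((a + 2 * k).choose k : ℝ) ≤ 2 ^ (a + 2 * k) := by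
    exact_mod_cast Nat.choose_le_two_pow _ _
  rw [norm_mul, norm_pow, Complex.norm_natCast, mul_pow, ← mul_assoc]
  refine mul_le_mul_of_nonneg_right (h.trans_eq ?_) (by positivity)
  rw [pow_add, pow_mul]
  norm_num

theorem summable_choose_add_two_mul_mul_pow (a : ℕ) {z : ℂ} (hz : 4 * ‖z‖ < 1) :
    Summable fun k : ℕ => ((a + 2 * k).choose k : ℂ) * z ^ k :=
  .of_norm_bounded ((summable_geometric_of_lt_one (by positivity) hz).mul_left (2 ^ a))
    fun k => norm_choose_add_two_mul_mul_pow_le a k z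

theorem norm_tsum_choose_add_two_mul_mul_pow_le (a : ℕ) {z : ℂ} (hz : 4 * ‖z‖ < 1) :
    ‖∑' k : ℕ, ((a + 2 * k).choose k : ℂ) * z ^ k‖ ≤ 2 ^ a * (1 - 4 * ‖z‖)⁻¹ :=
  tsum_of_norm_bounded ((hasSum_geometric_of_lt_one (by positivity) hz).mul_left (2 ^ a))
    fun k => norm_choose_add_two_mul_mul_pow_le a k z

/-- Pascal's rule, termwise. -/
theorem tsum_choose_add_two_mul_succ (a : ℕ) {z : ℂ} (hz : 4 * ‖z‖ < 1) :
    ∑' k : ℕ, ((a + 1 + 2 * k).choose k : ℂ) * z ^ k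
      = ∑' k : ℕ, ((a + 2 * k).choose k : ℂ) * z ^ k
        + z * ∑' k : ℕ, ((a + 2 + 2 * k).choose k : ℂ) * z ^ k := by
  rw [(summable_choose_add_two_mul_mul_pow (a + 1) hz).tsum_eq_zero_add,
    (summable_choose_add_two_mul_mul_pow a hz).tsum_eq_zero_add, ← tsum_mul_left,
    add_assoc (_ * _) (tsum _) (tsum _), ← Summable.tsum_add]
  · congr 1
    · simp
    · refine tsum_congr fun k => ?_
      rw [show a + 1 + 2 * (k + 1) = (a + 2 + 2 * k) + 1 by ring,
        show a + 2 * (k + 1) = a + 2 + 2 * k by ring, Nat.choose_succ_succ]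
      push_cast
      ring
  · exact (summable_nat_add_iff 1).2 (summable_choose_add_two_mul_mul_pow a hz)
  · exact (summable_choose_add_two_mul_mul_pow (a + 2) hz).mul_left z

theorem tsum_centralBinom_eq_one_add {z : ℂ} (hz : 4 * ‖z‖ < 1) :
    ∑' k : ℕ, ((0 + 2 * k).choose k : ℂ) * z ^ k
      = 1 + 2 * z * ∑' k : ℕ, ((1 + 2 * k).choose k : ℂ) * z ^ k := by
  rw [(summable_choose_add_two_mul_mul_pow 0 hz).tsum_eq_zero_add, ← tsum_mul_left]
  congr 1
  · simp
  · refine tsum_congr fun k => ?_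
    have h : (0 + 2 * (k + 1)).choose (k + 1) = 2 * (1 + 2 * k).choose k := by
      rw [show 0 + 2 * (k + 1) = (1 + 2 * k) + 1 by ring, Nat.choose_succ_succ,
        Nat.choose_symm_of_eq_add (show 1 + 2 * k = (k + 1) + k by ring)]
      ring
    rw [h]
    push_cast
    ring

/-- The generating function of the binomials `(a + 2k choose k)`, for a square root `S` of
`1 - 4z` close to `1`. -/
theorem hasSum_choose_add_two_mul_mul_pow {z S : ℂ} (hz : 4 * ‖z‖ < 1) (hS : S ^ 2 = 1 - 4 * z)
    (hS1 : ‖1 - S‖ < 1 / 2) (a : ℕ) :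
    HasSum (fun k : ℕ => ((a + 2 * k).choose k : ℂ) * z ^ k) ((2 / (1 + S)) ^ a / S) := by
  set B : ℕ → ℂ := fun a => ∑' k : ℕ, ((a + 2 * k).choose k : ℂ) * z ^ k with hB
  have hS0 : S ≠ 0 := by
    rintro rfl
    norm_num at hS1
  have hS2 : 1 + S ≠ 0 := by
    intro h
    rw [show S = -1 by linear_combination h] at hS1
    norm_num at hS1
  set c : ℂ := 2 / (1 + S) with hc
  have hcS : c * (1 + S) = 2 := div_mul_cancel₀ _ hS2
  have hzc : z * c = (1 - S) / 2 := by
    rw [hc]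
    field_simp
    linear_combination hS
  -- `c` is a root of `c = 1 + z c²`, the characteristic equation of `hrec`.
  have hquad : c * (1 - z * c) = 1 := by
    rw [hzc]
    linear_combination hcS / 2
  have hrec (a : ℕ) : B (a + 1) = B a + z * B (a + 2) := tsum_choose_add_two_mul_succ a hz
  have hstep (a : ℕ) : B (a + 1) - c * B a = (z * c) * (B (a + 2) - c * B (a + 1)) := by
    linear_combination c * hrec a - B (a + 1) * hquad
  have hiter (a n : ℕ) :
      B (a + 1) - c * B a = (z * c) ^ n * (B (a + n + 1) - c * B (a + n)) := by
    induction n with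
    | zero => simp
    | succ n ih => rw [ih, hstep (a + n), pow_succ]; ring_nf
  -- `B` grows at most like `2 ^ a` while `2 ‖z c‖ = ‖1 - S‖ < 1`, so the defect `B (a + 1) - c B a`
  -- vanishes as `n → ∞`.
  have hbound (a n : ℕ) : ‖B (a + 1) - c * B a‖
      ≤ (2 ^ a * (1 - 4 * ‖z‖)⁻¹ * (2 + ‖c‖)) * (2 * ‖z * c‖) ^ n := by
    rw [hiter a n, norm_mul, norm_pow]
    have h1 := norm_tsum_choose_add_two_mul_mul_pow_le (a + n + 1) hz
    have h2 := norm_tsum_choose_add_two_mul_mul_pow_le (a + n) hz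
    have h3 : ‖B (a + n + 1) - c * B (a + n)‖
        ≤ 2 ^ (a + n + 1) * (1 - 4 * ‖z‖)⁻¹ + ‖c‖ * (2 ^ (a + n) * (1 - 4 * ‖z‖)⁻¹) := by
      refine (norm_sub_le _ _).trans (add_le_add h1 ?_)
      rw [norm_mul]
      exact mul_le_mul_of_nonneg_left h2 (norm_nonneg _)
    refine (mul_le_mul_of_nonneg_left h3 (by positivity)).trans_eq ?_
    rw [mul_pow]
    ring
  have hlt : 2 * ‖z * c‖ < 1 := by
    rw [hzc, norm_div]
    norm_num
    linarith
  have hsucc (a : ℕ) : B (a + 1) = c * B a := by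
    have hlim := (tendsto_pow_atTop_nhds_zero_of_lt_one (by positivity) hlt).const_mul
      (2 ^ a * (1 - 4 * ‖z‖)⁻¹ * (2 + ‖c‖))
    rw [mul_zero] at hlim
    have := ge_of_tendsto' hlim (hbound a)
    exact sub_eq_zero.1 (norm_le_zero_iff.1 this)
  -- `B 0 = 1 + 2 z c B 0` and `1 - 2 z c = S`.
  have hzero : B 0 = 1 / S := by
    have h0 : B 0 = 1 + 2 * z * B 1 := tsum_centralBinom_eq_one_add hz
    rw [hsucc 0] at h0
    rw [eq_div_iff hS0]
    linear_combination h0 + 2 * B 0 * hzc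
  have hpow (a : ℕ) : B a = c ^ a / S := by
    induction a with
    | zero => rw [hzero, pow_zero]
    | succ a ih => rw [hsucc, ih, pow_succ]; ring
  rw [← hpow a]
  exact (summable_choose_add_two_mul_mul_pow a hz).hasSum

/-! ### Summing the triple series -/

/-- The general term of the series, indexed by the numbers `a`, `k`, `b` of plus signs,
two-cycles and minus signs. -/
noncomputable def tripleTerm (x y : ℂ) (t : ℕ × ℕ × ℕ) : ℂ :=
  y ^ t.1 / t.1.factorial * (((t.1 + 2 * t.2.1).choose t.2.1 : ℂ) * (x * y / 2) ^ t.2.1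
    * (((t.2.2 + (t.1 + 2 * t.2.1)).choose (t.1 + 2 * t.2.1) : ℂ) * x ^ t.2.2))

/-- Bounding each binomial by a power of two leaves a product of three geometric series. -/
theorem summable_tripleTerm {x y : ℂ} (hx : ‖x‖ < 1 / 4) (hy : ‖y‖ < 1 / 4) :
    Summable (tripleTerm x y) := by
  have hA := summable_geometric_of_lt_one (r := 4 * ‖y‖) (by positivity) (by linarith)
  have hK := summable_geometric_of_lt_one (r := 8 * (‖x‖ * ‖y‖)) (by positivity)
    (by nlinarith [norm_nonneg x, norm_nonneg y])
  have hB := summable_geometric_of_lt_one (r := 2 * ‖x‖) (by positivity) (by linarith)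
  have hKB := hK.mul_of_nonneg hB (fun _ => by positivity) (fun _ => by positivity)
  have hAll := hA.mul_of_nonneg hKB (fun _ => by positivity) (fun _ => by positivity)
  refine .of_norm_bounded hAll ?_
  rintro ⟨a, k, b⟩
  have h1 : ((a + 2 * k).choose k : ℝ) ≤ 2 ^ (a + 2 * k) := by
    exact_mod_cast Nat.choose_le_two_pow _ _
  have h2 : ((b + (a + 2 * k)).choose (a + 2 * k) : ℝ) ≤ 2 ^ (b + (a + 2 * k)) := by
    exact_mod_cast Nat.choose_le_two_pow _ _
  have h3 : ‖y‖ ^ a / (a.factorial : ℝ) ≤ ‖y‖ ^ a :=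
    div_le_self (by positivity) (by exact_mod_cast a.factorial_pos)
  simp only [tripleTerm, norm_mul, norm_div, norm_pow, Complex.norm_natCast]
  calc _ ≤ ‖y‖ ^ a * (2 ^ (a + 2 * k) * (‖x‖ * ‖y‖ / ‖(2 : ℂ)‖) ^ k
        * (2 ^ (b + (a + 2 * k)) * ‖x‖ ^ b)) := by gcongr
    _ = _ := by
      rw [show 8 * (‖x‖ * ‖y‖) = 2 ^ 2 * 2 ^ 2 * (‖x‖ * ‖y‖ / 2) by ring,
        show (4 : ℝ) = 2 * 2 by norm_num, Complex.norm_ofNat]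
      simp only [mul_pow, pow_add, pow_mul]
      ring

theorem hasSum_tripleTerm_minus {x : ℂ} (hx : ‖x‖ < 1) (y : ℂ) (a k : ℕ) :
    HasSum (fun b => tripleTerm x y (a, k, b))
      (y ^ a / a.factorial / (1 - x) ^ (a + 1)
        * (((a + 2 * k).choose k : ℂ) * (x * y / (2 * (1 - x) ^ 2)) ^ k)) := by
  have h := ((hasSum_choose_mul_geometric_of_norm_lt_one (a + 2 * k) hx).mul_left
    (((a + 2 * k).choose k : ℂ) * (x * y / 2) ^ k)).mul_left (y ^ a / (a.factorial : ℂ))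
  have hterm : y ^ a / (a.factorial : ℂ) * (((a + 2 * k).choose k : ℂ) * (x * y / 2) ^ k
        * (1 / (1 - x) ^ (a + 2 * k + 1)))
      = y ^ a / (a.factorial : ℂ) / (1 - x) ^ (a + 1)
        * (((a + 2 * k).choose k : ℂ) * (x * y / (2 * (1 - x) ^ 2)) ^ k) := by
    rw [show x * y / (2 * (1 - x) ^ 2) = x * y / 2 / (1 - x) ^ 2 by rw [div_div],
      div_pow _ ((1 - x) ^ 2), ← pow_mul, show a + 2 * k + 1 = a + 1 + 2 * k by ring,
      pow_add _ (a + 1)]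
    generalize (1 - x) ^ (a + 1) = u
    generalize (1 - x) ^ (2 * k) = v
    generalize (x * y / 2) ^ k = w
    rw [one_div, mul_inv]
    simp only [div_eq_mul_inv]
    ring
  rw [hterm] at h
  exact h

theorem hasSum_tripleTerm_cycles_minus {x y S : ℂ} (hx : ‖x‖ < 1 / 4) (hy : ‖y‖ < 1 / 4)
    (hS : S ^ 2 = 1 - 4 * (x * y / (2 * (1 - x) ^ 2))) (hS1 : ‖1 - S‖ < 1 / 2) (a : ℕ) :
    HasSum (fun kb : ℕ × ℕ => tripleTerm x y (a, kb))
      ((y / (1 - x) * (2 / (1 + S))) ^ a / a.factorial / ((1 - x) * S)) := by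
  have hx1 : 3 / 4 < ‖1 - x‖ := by
    have := norm_sub_norm_le 1 x
    rw [norm_one] at this
    linarith
  have hz : 4 * ‖x * y / (2 * (1 - x) ^ 2)‖ < 1 := by
    rw [norm_div, norm_mul, norm_mul, norm_pow, Complex.norm_ofNat, ← mul_div_assoc,
      div_lt_one (by positivity)]
    nlinarith [norm_nonneg x, norm_nonneg y]
  have hsum := ((summable_tripleTerm hx hy).prod_factor a).hasSum
  have h1 := hsum.prod_fiberwise (hasSum_tripleTerm_minus (by linarith) y a)
  have h2 := (hasSum_choose_add_two_mul_mul_pow hz hS hS1 a).mul_left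
    (y ^ a / a.factorial / (1 - x) ^ (a + 1))
  have hval : y ^ a / a.factorial / (1 - x) ^ (a + 1) * ((2 / (1 + S)) ^ a / S)
      = (y / (1 - x) * (2 / (1 + S))) ^ a / a.factorial / ((1 - x) * S) := by
    rw [mul_pow, div_pow y, pow_succ]
    generalize (2 / (1 + S)) ^ a = u
    simp only [div_eq_mul_inv, mul_inv]
    ring
  rw [← hval, ← h1.unique h2]
  exact hsum

theorem hasSum_tripleTerm {x y S : ℂ} (hx : ‖x‖ < 1 / 4) (hy : ‖y‖ < 1 / 4)
    (hS : S ^ 2 = 1 - 4 * (x * y / (2 * (1 - x) ^ 2))) (hS1 : ‖1 - S‖ < 1 / 2) :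
    HasSum (tripleTerm x y)
      (Complex.exp (y / (1 - x) * (2 / (1 + S))) / ((1 - x) * S)) := by
  have hsum := (summable_tripleTerm hx hy).hasSum
  have ha := hsum.prod_fiberwise (hasSum_tripleTerm_cycles_minus hx hy hS hS1)
  have hexp := (NormedSpace.expSeries_div_hasSum_exp
    (y / (1 - x) * (2 / (1 + S)))).div_const ((1 - x) * S)
  rw [← Complex.exp_eq_exp_ℂ] at hexp
  rw [← ha.unique hexp]
  exact hsum

/-! ### Estimates for the principal square root -/

theorem discSqrt_sq (x y : ℂ) : discSqrt x y ^ 2 = x ^ 2 - 2 * x * y - 2 * x + 1 := by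
  rw [discSqrt, one_div]
  exact Complex.cpow_ofNat_inv_pow _ 2

/-- The principal root has nonnegative real part, so `‖1 + R‖ ≥ 1` in `(1 - R)(1 + R) = 1 - R²`. -/
theorem norm_one_sub_discSqrt_le (x y : ℂ) :
    ‖1 - discSqrt x y‖ ≤ ‖2 * x * y + 2 * x - x ^ 2‖ := by
  have hsq := discSqrt_sq x y
  have hre : 0 ≤ (discSqrt x y).re := by
    rw [discSqrt]
    rcases eq_or_ne (x ^ 2 - 2 * x * y - 2 * x + 1) 0 with h0 | h0
    · simp [h0]
    · rw [Complex.cpow_def_of_ne_zero h0, Complex.exp_re]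
      refine mul_nonneg (Real.exp_pos _).le (Real.cos_nonneg_of_mem_Icc ?_)
      have him : (Complex.log (x ^ 2 - 2 * x * y - 2 * x + 1) * (1 / 2)).im
          = Complex.arg (x ^ 2 - 2 * x * y - 2 * x + 1) / 2 := by
        rw [mul_one_div, Complex.div_ofNat_im, Complex.log_im]
      rw [him]
      constructor <;>
        linarith [Complex.neg_pi_lt_arg (x ^ 2 - 2 * x * y - 2 * x + 1),
          Complex.arg_le_pi (x ^ 2 - 2 * x * y - 2 * x + 1)]
  have h1 : 1 ≤ ‖1 + discSqrt x y‖ := by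
    refine le_trans ?_ (Complex.re_le_norm _)
    simpa using hre
  rw [show 2 * x * y + 2 * x - x ^ 2 = (1 - discSqrt x y) * (1 + discSqrt x y) by
    linear_combination hsq, norm_mul]
  exact le_mul_of_one_le_right (norm_nonneg _) h1

theorem norm_one_sub_discSqrt_lt {x y : ℂ} (hx : ‖x‖ < 1 / 20) (hy : ‖y‖ < 1 / 20) :
    ‖1 - discSqrt x y‖ < 1 / 8 := by
  refine (norm_one_sub_discSqrt_le x y).trans_lt ?_
  have h1 : ‖2 * x * y + 2 * x - x ^ 2‖ ≤ 2 * ‖x‖ * ‖y‖ + 2 * ‖x‖ + ‖x‖ ^ 2 := by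
    refine (norm_sub_le _ _).trans (add_le_add ((norm_add_le _ _).trans_eq ?_) (norm_pow x 2).le)
    simp
  nlinarith [norm_nonneg x, norm_nonneg y]

theorem discSqrt_ne {x y : ℂ} (hx : ‖x‖ < 1 / 20) (hy : ‖y‖ < 1 / 20) :
    discSqrt x y ≠ 0 ∧ discSqrt x y ≠ x ∧ 1 - x + discSqrt x y ≠ 0 := by
  have h := norm_one_sub_discSqrt_lt hx hy
  refine ⟨fun h0 => ?_, fun h0 => ?_, fun h0 => ?_⟩
  · rw [h0] at h
    norm_num at h
  · rw [h0] at h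
    have := norm_sub_norm_le 1 x
    rw [norm_one] at this
    linarith
  · have h2 : ‖(2 : ℂ)‖ ≤ ‖x‖ + ‖1 - discSqrt x y‖ := by
      rw [show (2 : ℂ) = x + (1 - discSqrt x y) by linear_combination h0]
      exact norm_add_le _ _
    rw [Complex.norm_ofNat] at h2
    linarith

/-! ### From the triple series to the closed form -/

theorem hasSum_signedInvolutionCount {x y s : ℂ} (h : HasSum (tripleTerm x y) s) :
    HasSum (fun pq : ℕ × ℕ =>
      (signedInvolutionCount pq.1 pq.2 : ℂ) * x ^ pq.2 * (y ^ pq.1 / (pq.1.factorial : ℂ))) s := by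
  set G : (ℕ × ℕ) × ℕ → ℂ := fun u =>
    (((Finset.univ.filter (fun π : Equiv.Perm (Fin (u.1.1 + u.1.2)) =>
        π.cycleType = Multiset.replicate u.2 2)).card
      * if u.2 ≤ u.1.1 ∧ u.2 ≤ u.1.2 then (u.1.1 + u.1.2 - 2 * u.2).choose (u.1.1 - u.2) else 0
      : ℕ) : ℂ) * x ^ u.1.2 * (y ^ u.1.1 / (u.1.1.factorial : ℂ)) with hG
  -- The range of `g` is `k ≤ p ∧ k ≤ q`, outside which `G` is zero.
  set g : ℕ × ℕ × ℕ → (ℕ × ℕ) × ℕ := fun t => ((t.1 + t.2.1, t.2.2 + t.2.1), t.2.1) with hg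
  have hinj : Function.Injective g := by
    rintro ⟨a, k, b⟩ ⟨a', k', b'⟩ h
    simp only [hg, Prod.mk.injEq] at h ⊢
    omega
  have hsupp : ∀ u ∉ Set.range g, G u = 0 := by
    rintro ⟨⟨p, q⟩, k⟩ hu
    have hk : ¬ (k ≤ p ∧ k ≤ q) := fun hk =>
      hu ⟨(p - k, k, q - k), by simp [hg, Nat.sub_add_cancel hk.1, Nat.sub_add_cancel hk.2]⟩
    simp [hG, hk]
  have hcomp : G ∘ g = tripleTerm x y := by
    funext ⟨a, k, b⟩
    have := card_cycleType_replicate_two_mul_choose_div_factorial k a b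
    simp only [Function.comp, hG, hg, tripleTerm, le_add_iff_nonneg_left, zero_le, and_self,
      if_true, Nat.cast_mul]
    rw [mul_div_assoc', mul_right_comm, mul_div_right_comm, mul_div_right_comm, this]
    simp only [div_pow, mul_pow, pow_add]
    ring
  have hGsum : HasSum G s := by
    rw [← hinj.hasSum_iff hsupp, hcomp]
    exact h
  refine hGsum.prod_fiberwise fun pq => ?_
  rw [signedInvolutionCount_eq_sum, Nat.cast_sum, Finset.sum_mul, Finset.sum_mul]
  refine hasSum_sum_of_ne_finset_zero fun k hk => ?_
  rw [Finset.mem_range] at hk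
  have : ¬ (k ≤ pq.1 ∧ k ≤ pq.2) := by omega
  simp [hG, this]

theorem hasSum_signedInvolutionCount_closed_form {x y : ℂ} (hx : ‖x‖ < 1 / 20)
    (hy : ‖y‖ < 1 / 20) :
    HasSum (fun pq : ℕ × ℕ =>
      (signedInvolutionCount pq.1 pq.2 : ℂ) * x ^ pq.2 * (y ^ pq.1 / (pq.1.factorial : ℂ)))
      (Complex.exp (2 * y / (1 - x + discSqrt x y)) / discSqrt x y) := by
  have hx1 : 3 / 4 < ‖1 - x‖ := by
    have := norm_sub_norm_le 1 x
    rw [norm_one] at this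
    linarith
  have hx0 : 1 - x ≠ 0 := norm_pos_iff.1 (by linarith)
  have hR := norm_one_sub_discSqrt_lt hx hy
  have hR1 := (discSqrt_ne hx hy).2.2
  have hsq := discSqrt_sq x y
  have hS : (discSqrt x y / (1 - x)) ^ 2 = 1 - 4 * (x * y / (2 * (1 - x) ^ 2)) := by
    field_simp
    linear_combination 2 * hsq
  -- This closeness to `1` selects the right root of `1 - 4z`.
  have hS1 : ‖1 - discSqrt x y / (1 - x)‖ < 1 / 2 := by
    rw [show 1 - discSqrt x y / (1 - x) = ((1 - discSqrt x y) - x) / (1 - x) by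
      field_simp
      ring, norm_div, div_lt_iff₀ (by linarith)]
    have := norm_sub_le (1 - discSqrt x y) x
    linarith
  have h := hasSum_signedInvolutionCount
    (hasSum_tripleTerm (by linarith) (by linarith) hS hS1)
  have he : y / (1 - x) * (2 / (1 + discSqrt x y / (1 - x))) = 2 * y / (1 - x + discSqrt x y) := by
    rw [show 1 + discSqrt x y / (1 - x) = (1 - x + discSqrt x y) / (1 - x) by
      field_simp]
    field_simp
  rwa [he, mul_div_cancel₀ _ hx0] at h

theorem corollary1p5 :
    ∃ ε : ℝ, 0 < ε ∧ ∀ x y : ℂ, ‖x‖ < ε → ‖y‖ < ε →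
      (x ≠ 0 →
        -x ^ 2 + 2 * x * y + 2 * x - 1 + x * discSqrt x y ≠ 0 ∧
        HasSum
          (fun pq : ℕ × ℕ =>
            (signedInvolutionCount pq.1 pq.2 : ℂ) * x ^ pq.2 * (y ^ pq.1 / (pq.1.factorial : ℂ)))
          (Complex.exp ((1 - x - discSqrt x y) / x) * (x - discSqrt x y) /
            (-x ^ 2 + 2 * x * y + 2 * x - 1 + x * discSqrt x y))) ∧
      (x = 0 →
        HasSum
          (fun pq : ℕ × ℕ =>
            (signedInvolutionCount pq.1 pq.2 : ℂ) * x ^ pq.2 * (y ^ pq.1 / (pq.1.factorial : ℂ)))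
          (Complex.exp y)) := by
  refine ⟨1 / 20, by norm_num, fun x y hx hy => ?_⟩
  have hmain := hasSum_signedInvolutionCount_closed_form hx hy
  obtain ⟨hR0, hRx, hR1⟩ := discSqrt_ne hx hy
  have hsq := discSqrt_sq x y
  generalize hR : discSqrt x y = R at *
  have hden : -x ^ 2 + 2 * x * y + 2 * x - 1 + x * R = R * (x - R) := by
    linear_combination hsq
  refine ⟨fun hx0 => ?_, ?_⟩
  · rw [hden]
    have hxR := sub_ne_zero.2 hRx.symm
    refine ⟨mul_ne_zero hR0 hxR, ?_⟩
    rw [mul_div_mul_right _ _ hxR]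
    have he : (1 - x - R) / x = 2 * y / (1 - x + R) := by
      rw [div_eq_div_iff hx0 hR1]
      linear_combination -hsq
    rwa [he]
  · rintro rfl
    have : R = 1 := by
      rw [← hR, discSqrt]
      simp
    subst this
    convert hmain using 1
    norm_num
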